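/- Conventions. For a finite group $X$, $d(X)$ is the smallest number of generators of $X$, $\exp(X)$ its exponent, $Z(X)$ its centre, $X'$ its commutator subgroup. A $\mathbb{Z}$-bilinear map $\mu\colon A\times B\to C$ of abelian groups is non-degenerate if $\mu(a,B)=0$ implies $a=0$ and $\mu(A,b)=0$ implies $b=0$. Its Heisenberg group $\mathrm{H}(\mu)$ is the set $A\times B\times C$ with $(a,b,c)(a',b',c')=(a+a',b+b',c+\mu(a,b')+c')$; it is non-degenerate if $Z(\mathrm{H}(\mu))=\{(0,0,c):c\in C\}$. It lies in the central-by-abelian extension $\mathcal{H}(\mu)\colon 1\to C\to \mathrm{H}(\mu)\to A\times B\to 1$ with maps $c\mapsto(0,0,c)$ and $(a,b,c)\mapsto(a,b)$. For a group $G$ of nilpotency class at most $2$ let $\mathcal{Z}(G)\colon 1\to Z(G)\to G\to G/Z(G)\to 1$ be the natural extension. A monomorphism of extensions is a triple of injective homomorphisms between the corresponding terms that makes both squares commute. Products of extensions are taken termwise. Theorem. Let $G$ be a finite nilpotent group of class at most $2$ and let $n=d(Z(G))$. Then there exist finite abelian groups $A,B,C$ and $A_i,C_i$ ($1\le i\le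 n$), non-degenerate $\mathbb{Z}$-bilinear maps $\mu\colon A\times B\to C$ and $\mu_i\colon A_i\times A_i\to C_i$ (so that $\mathrm{H}(\mu)$ and all $\mathrm{H}(\mu_i)$ are non-degenerate), and monomorphisms of central-by-abelian extensions \[\mathcal{Z}(G)\rightarrowtail\mathcal{H}(\mu)\rightarrowtail\prod_{i=1}^n\mathcal{H}(\mu_i)\] such that every prime divisor of the order of any of the groups $A$, $B$, $A_i$, $C_i$ or of any group occurring in these extensions divides $|G|$, and \[d(A),\ d(B),\ d(A_i\times A_i)\le d(G/Z(G)),\qquad d(C_i)\le 1,\qquad d(C_i)\le d(C)=d(Z(G))\] for all $i$ (in particular each $C_i$ is cyclic), and \[\exp(G/Z(G))\mid\exp(A\times B)\mid\exp(G')\mid\exp(Z(G))\mid\exp(C)\mid\exp(G).\] -/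

import Mathlib

universe u

/-! ### Central-by-abelian extensions and their morphisms -/

namespace GroupExtension

/-- A short exact sequence `1 → C → G → M → 1` of groups is central-by-abelian if the image of `C`
is contained in the centre of `G` and `M` is abelian. -/
def IsCentralByAbelian {C G M : Type*} [Group C] [Group G] [Group M]
    (S : GroupExtension C G M) : Prop :=
  S.inl.range ≤ Subgroup.center G ∧ ∀ x y : M, x * y = y * x

/-- A central-by-abelian extension `1 → C → G → M → 1` is non-degenerate if the image of `C` is the
whole centre of `G`. -/
def IsNondegenerate {C G M : Type*} [Group C] [Group G] [Group M]
    (S : GroupExtension C G M) : Prop :=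
  S.IsCentralByAbelian ∧ S.inl.range = Subgroup.center G

/-- A morphism of short exact sequences of groups: three homomorphisms making both squares
commute. -/
structure Morphism {C G M C' G' M' : Type*} [Group C] [Group G] [Group M]
    [Group C'] [Group G'] [Group M']
    (S : GroupExtension C G M) (S' : GroupExtension C' G' M') where
  left : C →* C'
  mid : G →* G'
  right : M →* M'
  mid_inl : ∀ c : C, mid (S.inl c) = S'.inl (left c)
  rightHom_mid : ∀ g : G, S'.rightHom (mid g) = right (S.rightHom g)

/-- A monomorphism of short exact sequences: all three homomorphisms are injective. -/
def Morphism.IsMono {C G M C' G' M' : Type*} [Group C] [Group G] [Group M]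
    [Group C'] [Group G'] [Group M']
    {S : GroupExtension C G M} {S' : GroupExtension C' G' M'} (f : S.Morphism S') : Prop :=
  Function.Injective f.left ∧ Function.Injective f.mid ∧ Function.Injective f.right

/-- The extension `1 → Z(G) → G → G / Z(G) → 1` given by inclusion and projection. -/
def ofCenter (G : Type*) [Group G] :
    GroupExtension (Subgroup.center G) G (G ⧸ Subgroup.center G) where
  inl := (Subgroup.center G).subtype
  rightHom := QuotientGroup.mk' (Subgroup.center G)
  inl_injective := Subtype.val_injective
  range_inl_eq_ker_rightHom := by simp
  rightHom_surjective := QuotientGroup.mk'_surjective _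

/-- The direct product of a family of extensions, taken termwise. -/
def pi {ι : Type*} {C G M : ι → Type*} [∀ i, Group (C i)] [∀ i, Group (G i)] [∀ i, Group (M i)]
    (S : ∀ i, GroupExtension (C i) (G i) (M i)) :
    GroupExtension (∀ i, C i) (∀ i, G i) (∀ i, M i) where
  inl := MonoidHom.piMap fun i => (S i).inl
  rightHom := MonoidHom.piMap fun i => (S i).rightHom
  inl_injective := fun _ _ h => funext fun i => (S i).inl_injective (congrFun h i)
  range_inl_eq_ker_rightHom := by
    ext g
    constructor
    · rintro ⟨c, rfl⟩
      exact funext fun i => (S i).rightHom_inl (c i)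
    · intro h
      have h' : ∀ i, ∃ c, (S i).inl c = g i := fun i => by
        have : g i ∈ (S i).rightHom.ker := congrFun h i
        rw [← (S i).range_inl_eq_ker_rightHom] at this
        exact this
      choose c hc using h'
      exact ⟨c, funext hc⟩
  rightHom_surjective := fun m =>
    ⟨fun i => ((S i).rightHom_surjective (m i)).choose,
      funext fun i => ((S i).rightHom_surjective (m i)).choose_spec⟩

end GroupExtension

/-! ### Heisenberg groups -/

/-- A bilinear map `μ : A × B → C` of abelian groups is non-degenerate if `μ(a, B) = 0` implies
`a = 0` and `μ(A, b) = 0` implies `b = 0`. -/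
def IsNondegenerateBilin {A B C : Type*} [AddCommGroup A] [AddCommGroup B] [AddCommGroup C]
    (μ : A →+ B →+ C) : Prop :=
  (∀ a, (∀ b, μ a b = 0) → a = 0) ∧ (∀ b, (∀ a, μ a b = 0) → b = 0)

/-- The underlying set `A × B × C` of the Heisenberg group of a bilinear map `μ : A × B → C`. -/
@[ext]
structure HeisenbergGroup {A B C : Type*} [AddCommGroup A] [AddCommGroup B] [AddCommGroup C]
    (μ : A →+ B →+ C) where
  fst : A
  snd : B
  cen : C

namespace HeisenbergGroup

/-- The group law `(a, b, c) * (a', b', c') = (a + a', b + b', c + μ(a, b') + c')`, that is,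
multiplication of upper unitriangular `3 × 3` matrices via `μ`. -/
instance {A B C : Type*} [AddCommGroup A] [AddCommGroup B] [AddCommGroup C]
    (μ : A →+ B →+ C) : Group (HeisenbergGroup μ) where
  mul x y := ⟨x.fst + y.fst, x.snd + y.snd, x.cen + μ x.fst y.snd + y.cen⟩
  one := ⟨0, 0, 0⟩
  inv x := ⟨-x.fst, -x.snd, μ x.fst x.snd - x.cen⟩
  mul_assoc x y z := by
    change HeisenbergGroup.mk (x.fst + y.fst + z.fst) (x.snd + y.snd + z.snd)
        (x.cen + μ x.fst y.snd + y.cen + μ (x.fst + y.fst) z.snd + z.cen) =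
      HeisenbergGroup.mk (x.fst + (y.fst + z.fst)) (x.snd + (y.snd + z.snd))
        (x.cen + μ x.fst (y.snd + z.snd) + (y.cen + μ y.fst z.snd + z.cen))
    simp only [mk.injEq, map_add, AddMonoidHom.add_apply]
    exact ⟨by abel, by abel, by abel⟩
  one_mul x := by
    change HeisenbergGroup.mk (0 + x.fst) (0 + x.snd) (0 + μ 0 x.snd + x.cen) = x
    simp
  mul_one x := by
    change HeisenbergGroup.mk (x.fst + 0) (x.snd + 0) (x.cen + μ x.fst 0 + 0) = x
    simp
  inv_mul_cancel x := by
    change HeisenbergGroup.mk (-x.fst + x.fst) (-x.snd + x.snd)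
      (μ x.fst x.snd - x.cen + μ (-x.fst) x.snd + x.cen) = HeisenbergGroup.mk 0 0 0
    simp only [neg_add_cancel, map_neg, AddMonoidHom.neg_apply, mk.injEq, true_and]
    abel

/-- The extension `1 → C → H(μ) → A × B → 1` with maps `c ↦ (0, 0, c)` and
`(a, b, c) ↦ (a, b)`. -/
def extension {A B C : Type*} [AddCommGroup A] [AddCommGroup B] [AddCommGroup C]
    (μ : A →+ B →+ C) :
    GroupExtension (Multiplicative C) (HeisenbergGroup μ) (Multiplicative (A × B)) where
  inl :=
    { toFun := fun c => ⟨0, 0, c.toAdd⟩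
      map_one' := rfl
      map_mul' := fun c c' => by
        change HeisenbergGroup.mk _ _ _ = HeisenbergGroup.mk (0 + 0) (0 + 0)
          (c.toAdd + μ 0 0 + c'.toAdd)
        simp }
  rightHom :=
    { toFun := fun x => Multiplicative.ofAdd (x.fst, x.snd)
      map_one' := rfl
      map_mul' := fun _ _ => rfl }
  inl_injective := fun _ _ h => congrArg HeisenbergGroup.cen h
  range_inl_eq_ker_rightHom := by
    ext ⟨a, b, c⟩
    constructor
    · rintro ⟨c', h⟩
      obtain rfl : 0 = a := congrArg HeisenbergGroup.fst h
      obtain rfl : 0 = b := congrArg HeisenbergGroup.snd h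
      rfl
    · intro h
      have h' : ((a, b) : A × B) = (0, 0) := h
      obtain ⟨rfl, rfl⟩ := Prod.mk.inj h'
      exact ⟨Multiplicative.ofAdd c, rfl⟩
  rightHom_surjective := fun m => ⟨⟨m.toAdd.1, m.toAdd.2, 0⟩, rfl⟩

end HeisenbergGroup

/-! Put e = exp(G), K = ℤ/e and M = G/Z(G). By duality there are n = d(Z(G)) characters χ_i : Z(G) →
K with trivial common kernel. Each turns the commutator of G into an alternating form ω_i on M with
values in a cyclic group. Dividing out radicals and splitting off hyperbolic planes
(`exists_isHyperbolicPullback`) gives a surjection p_i : M → L_i × L_i and a non-degenerate ν_i on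
L_i such that ω_i is the antisymmetrization of β_i(x, y) = ν_i((p_i x)₁, (p_i y)₂). These L_i and
ν_i serve as A_i and μ_i, with C_i = K.

To map G to H(ν_i) one needs φ_i : G → K that restricts to χ_i and has coboundary β_i
(`exists_extension_with_coboundary`). Twist G × K by -β_i and divide by the graph of -χ_i. The
quotient is abelian because β_i antisymmetrizes to χ_i of the commutator, and it is killed by e
because g^e = 1 on all of G and e(e-1)/2 kills M. It contains K, which is therefore a direct factor;
a retraction onto K yields φ_i.

Together the n maps embed G: an element killed by all p_i has all its commutators in the common
kernel of the χ_i, so it is central, and on the centre the χ_i are jointly injective. A and B are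
the images of M in ∏ L_i under the first and the second components, and C = K^n. The bounds hold
because A, B and L_i × L_i are quotients of M, while M embeds in A × B. -/

open scoped commutatorElement

/-! ### Characters of finite abelian groups with values in a cyclic group -/

section Duality

variable {K : Type*} [AddCommGroup K] [IsAddCyclic K] {e : ℕ} [NeZero e]

/-- Modelling K inside ℂˣ makes the extension of complex characters and the self-duality of finite
abelian groups available for K-valued characters. -/
theorem nonempty_mulEquiv_rootsOfUnity (hK : Nat.card K = e) :
    Nonempty (Multiplicative K ≃* rootsOfUnity e ℂ) := by
  refine ⟨mulEquivOfCyclicCardEq ?_⟩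
  rw [HasEnoughRootsOfUnity.natCard_rootsOfUnity ℂ e]
  exact hK

/-- A finite cyclic group of order `e` is a direct factor of every finite abelian group of
exponent dividing `e` that contains it. -/
theorem exists_retraction_of_injective (hK : Nat.card K = e) {E : Type*} [CommGroup E] [Finite E]
    (hE : ∀ x : E, x ^ e = 1) (f : Multiplicative K →* E) (hf : Function.Injective f) :
    ∃ r : E →* Multiplicative K, ∀ k, r (f k) = k := by
  obtain ⟨ε⟩ := nonempty_mulEquiv_rootsOfUnity hK
  have : NeZero (Monoid.exponent E) := ⟨Monoid.exponent_ne_zero_of_finite⟩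
  let F : Multiplicative K ≃* f.range := MonoidHom.ofInjective hf
  obtain ⟨ψ, hψ⟩ := MonoidHom.domRestrict_surjective ℂ f.range
    (((rootsOfUnity e ℂ).subtype.comp ε.toMonoidHom).comp F.symm.toMonoidHom)
  -- The extended character a priori takes values in ℂˣ; since e kills E, they are e-th roots of
  -- unity and can be carried back to K.
  have hmem : ∀ x, ψ x ∈ rootsOfUnity e ℂ := fun x => by
    rw [mem_rootsOfUnity, ← map_pow, hE, map_one]
  refine ⟨ε.symm.toMonoidHom.comp (ψ.codRestrict _ hmem), fun k => ?_⟩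
  have h1 : ψ (f k) = ε k := by
    have h := DFunLike.congr_fun hψ (F k)
    have h' : ψ (F k) = ε (F.symm (F k)) := h
    rwa [MulEquiv.symm_apply_apply] at h'
  have h2 : ψ.codRestrict _ hmem (f k) = ε k := Subtype.ext h1
  simp [h2]

/-- A finite abelian group `Z` of exponent dividing `e` embeds in a product of `d(Z)` cyclic groups
of order `e`. -/
theorem exists_jointly_injective_characters (hK : Nat.card K = e) {Z : Type*} [CommGroup Z]
    [Finite Z] (hZ : ∀ z : Z, z ^ e = 1) :
    ∃ χ : Fin (Group.rank Z) → Z →* Multiplicative K, ∀ z, (∀ i, χ i z = 1) → z = 1 := by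
  obtain ⟨ε⟩ := nonempty_mulEquiv_rootsOfUnity hK
  have : NeZero (Monoid.exponent Z) := ⟨Monoid.exponent_ne_zero_of_finite⟩
  -- The dual group is isomorphic to Z, so it has a generating set of d(Z) characters; a point
  -- killed by these is killed by every character.
  obtain ⟨D⟩ := CommGroup.monoidHom_mulEquiv_of_hasEnoughRootsOfUnity Z ℂ
  have : Finite (Z →* ℂˣ) := Finite.of_equiv _ D.symm.toEquiv
  obtain ⟨S, hS, hgen⟩ := Group.rank_spec (Z →* ℂˣ)
  rw [Group.rank_congr D] at hS
  let s : Fin (Group.rank Z) ≃ S := (finCongr hS.symm).trans S.equivFin.symm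
  have hmem : ∀ (ψ : Z →* ℂˣ) (z : Z), ψ z ∈ rootsOfUnity e ℂ := fun ψ z => by
    rw [mem_rootsOfUnity, ← map_pow, hZ, map_one]
  refine ⟨fun i => ε.symm.toMonoidHom.comp ((s i).1.codRestrict _ (hmem _)), fun z hz => ?_⟩
  have hs : ∀ ψ ∈ S, ψ z = 1 := fun ψ hψ => by
    have h := hz (s.symm ⟨ψ, hψ⟩)
    have h' : ψ.codRestrict _ (hmem ψ) z = 1 := by simpa [Equiv.apply_symm_apply] using h
    exact congrArg Subtype.val h'
  by_contra hne
  obtain ⟨ψ, hψ⟩ := CommGroup.exists_apply_ne_one_of_hasEnoughRootsOfUnity Z ℂ hne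
  refine hψ ?_
  have hle : Subgroup.closure (S : Set (Z →* ℂˣ)) ≤ (MonoidHom.eval z : (Z →* ℂˣ) →* ℂˣ).ker :=
    (Subgroup.closure_le _).2 fun ψ hψ => hs ψ hψ
  rw [hgen] at hle
  exact hle (Subgroup.mem_top ψ)

end Duality

/-! ### The rank of a homocyclic group -/

/-- The homocyclic group `(ℤ/e)ⁿ` needs `n` generators. -/
theorem rank_pi_cyclic {K : Type*} [AddCommGroup K] [IsAddCyclic K] [Finite K]
    [Nontrivial K] (n : ℕ) : AddGroup.rank (Fin n → K) = n := by
  classical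
  apply le_antisymm
  · obtain ⟨g, hg⟩ := IsAddCyclic.exists_generator (α := K)
    have hgen : AddSubgroup.closure
        ((Finset.univ.image fun i : Fin n => Pi.single i g : Finset (Fin n → K)) :
          Set (Fin n → K)) = ⊤ := by
      rw [eq_top_iff]
      intro x _
      rw [← Finset.univ_sum_single x]
      refine AddSubgroup.sum_mem _ fun i _ => ?_
      obtain ⟨k, hk⟩ := AddSubgroup.mem_zmultiples_iff.1 (hg (x i))
      rw [← hk, Pi.single_smul]
      exact AddSubgroup.zsmul_mem _ (AddSubgroup.subset_closure (by simp)) _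
    refine (AddGroup.rank_le hgen).trans (Finset.card_image_le.trans ?_)
    simp
  · obtain ⟨S, hS, hgen⟩ := AddGroup.rank_spec (Fin n → K)
    set e := Nat.card K with he
    have he1 : 1 < e := Finite.one_lt_card
    have : NeZero e := ⟨by omega⟩
    have hkill : ∀ x : Fin n → K, e • x = 0 := fun x => funext fun i => by
      simp [he]
    -- The lower bound is a count: as e kills the group, combinations with coefficients mod e
    -- exhaust it, so e^n ≤ e^|S|.
    let Φ : (S → ZMod e) → (Fin n → K) := fun t => ∑ s : S, (t s).val • s.1
    have hΦ : Function.Surjective Φ := fun x => by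
      have hx : x ∈ AddSubgroup.closure (S : Set (Fin n → K)) := hgen ▸ AddSubgroup.mem_top x
      have hval : ∀ (k : ℕ) (y : Fin n → K), ((k : ZMod e)).val • y = k • y := fun k y => by
        rw [ZMod.val_natCast]
        conv_rhs => rw [← Nat.mod_add_div k e, add_smul, mul_comm, mul_smul, hkill, smul_zero,
          add_zero]
      have hadd : ∀ t u, Φ (t + u) = Φ t + Φ u := fun t u => by
        simp only [Φ, ← Finset.sum_add_distrib, ← add_smul]
        refine Finset.sum_congr rfl fun s _ => ?_
        rw [← hval ((t s).val + (u s).val)]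
        simp
      let Ψ : (S → ZMod e) →+ (Fin n → K) := AddMonoidHom.mk' Φ hadd
      have hle : AddSubgroup.closure (S : Set (Fin n → K)) ≤ Ψ.range := by
        rw [AddSubgroup.closure_le]
        intro s hs
        refine ⟨Pi.single ⟨s, hs⟩ 1, ?_⟩
        change ∑ r : S, _ = _
        rw [Finset.sum_eq_single ⟨s, hs⟩]
        · have := hval 1 s
          simpa using this
        · intro r _ hr
          simp [Pi.single_eq_of_ne hr]
        · simp
      exact hle hx
    have hcard := Nat.card_le_card_of_surjective Φ hΦ
    rw [Nat.card_fun, Nat.card_fun, ← he, Nat.card_zmod] at hcard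
    simp only [Nat.card_eq_fintype_card, Fintype.card_fin, Fintype.card_coe, hS] at hcard
    exact (Nat.pow_le_pow_iff_right he1).1 hcard

/-! ### Alternating forms with values in a finite cyclic group -/

/-- In a finite cyclic group, an element killed by the order of `z` is a multiple of `z`. -/
theorem mem_zmultiples_of_addOrderOf_nsmul_eq_zero {K : Type*} [AddCommGroup K] [IsAddCyclic K]
    [Finite K] {z w : K} (h : addOrderOf z • w = 0) : w ∈ AddSubgroup.zmultiples z := by
  classical
  have := Fintype.ofFinite K
  have hpos : 0 < addOrderOf z := addOrderOf_pos z
  set T : Finset K := Finset.univ.filter fun a => addOrderOf z • a = 0 with hT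
  -- A cyclic group has at most d elements killed by d, and the multiples of z already supply d of
  -- them.
  have hle : T.card ≤ addOrderOf z := IsAddCyclic.card_nsmul_eq_zero_le hpos
  have hsub : (AddSubgroup.zmultiples z : Set K).toFinset ⊆ T := by
    intro a ha
    obtain ⟨k, rfl⟩ := AddSubgroup.mem_zmultiples_iff.1 (by simpa using ha)
    simp only [hT, Finset.mem_filter, Finset.mem_univ, true_and]
    rw [smul_comm, addOrderOf_nsmul_eq_zero, smul_zero]
  have hcard : (AddSubgroup.zmultiples z : Set K).toFinset.card = addOrderOf z := by
    rw [Set.toFinset_card, ← Nat.card_eq_fintype_card]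
    exact Nat.card_zmultiples z
  have heq := Finset.eq_of_subset_of_card_le hsub (hcard ▸ hle)
  have : w ∈ T := by simp [hT, h]
  rw [← heq] at this
  simpa using this

/-- A bilinear map into a finite cyclic group has a value `z` such that every value is a multiple
of `z`. -/
theorem exists_value_generating_values {M K : Type*} [AddCommGroup M] [Finite M] [AddCommGroup K]
    [IsAddCyclic K] [Finite K] (ω : M →+ M →+ K) :
    ∃ x y, ∀ u v, ω u v ∈ AddSubgroup.zmultiples (ω x y) := by
  have : Finite ω.range := Finite.of_surjective _ ω.rangeRestrict_surjective
  -- Choose x so that the order of ω x is the exponent of the image of ω, then y so that ω x y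
  -- generates the cyclic group of values of ω x. The order of ω x y then kills ω x, hence every ω
  -- u.
  obtain ⟨⟨_, x, rfl⟩, hx⟩ := AddMonoid.exists_addOrderOf_eq_exponent
    (G := ω.range) AddMonoid.ExponentExists.of_finite
  obtain ⟨⟨_, y, rfl⟩, hy⟩ := IsAddCyclic.exists_generator (α := (ω x).range)
  refine ⟨x, y, fun u v => mem_zmultiples_of_addOrderOf_nsmul_eq_zero ?_⟩
  have h1 : addOrderOf (ω x y) • ω x = 0 := by
    ext w
    obtain ⟨k, hk⟩ := AddSubgroup.mem_zmultiples_iff.1 (hy ⟨ω x w, w, rfl⟩)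
    have hk' : k • ω x y = ω x w := congrArg Subtype.val hk
    rw [AddMonoidHom.nsmul_apply, ← hk', smul_comm, addOrderOf_nsmul_eq_zero, smul_zero]
    rfl
  have h2 : AddMonoid.exponent ω.range ∣ addOrderOf (ω x y) := by
    rw [← hx]
    exact addOrderOf_dvd_of_nsmul_eq_zero (Subtype.ext h1)
  have h3 : addOrderOf (ω x y) • (⟨ω u, u, rfl⟩ : ω.range) = 0 := by
    obtain ⟨c, hc⟩ := h2
    rw [hc, mul_comm, mul_smul, AddMonoid.exponent_nsmul_eq_zero, smul_zero]
  have h4 : addOrderOf (ω x y) • ω u = 0 := congrArg Subtype.val h3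
  rw [← AddMonoidHom.nsmul_apply, h4]
  rfl

/-- `ω` is the pull-back along `p : M → L × L` of the alternating form
`((a, b), (a', b')) ↦ ν a b' - ν a' b` attached to a non-degenerate bilinear map `ν`. -/
structure IsHyperbolicPullback {M L K : Type*} [AddCommGroup M] [AddCommGroup L] [AddCommGroup K]
    (ω : M → M → K) (p : M →+ L × L) (ν : L →+ L →+ K) : Prop where
  surjective : Function.Surjective p
  nondegenerate : IsNondegenerateBilin ν
  apply_eq : ∀ x y, ω x y = ν (p x).1 (p y).2 - ν (p y).1 (p x).2

theorem exists_zmod_addEquiv_zmultiples {K : Type*} [AddCommGroup K] (z : K) :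
    ∃ ε : ZMod (addOrderOf z) ≃+ AddSubgroup.zmultiples z, ∀ k : ℤ, (ε k : K) = k • z := by
  have h0 : zmultiplesHom K z (addOrderOf z) = 0 := by simp [addOrderOf_nsmul_eq_zero]
  let ψ : ZMod (addOrderOf z) →+ K := ZMod.lift _ ⟨zmultiplesHom K z, h0⟩
  have hψ : ∀ k : ℤ, ψ k = k • z := fun k => by simp [ψ]
  have hmem : ∀ s, ψ s ∈ AddSubgroup.zmultiples z := fun s => by
    obtain ⟨k, rfl⟩ := ZMod.intCast_surjective s
    exact ⟨k, (hψ k).symm⟩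
  refine ⟨AddEquiv.ofBijective (ψ.codRestrict _ hmem) ⟨?_, ?_⟩, hψ⟩
  · rw [injective_iff_map_eq_zero]
    intro s hs
    obtain ⟨k, rfl⟩ := ZMod.intCast_surjective s
    have : k • z = 0 := by rw [← hψ]; exact congrArg Subtype.val hs
    rw [ZMod.intCast_zmod_eq_zero_iff_dvd]
    exact addOrderOf_dvd_iff_zsmul_eq_zero.2 this
  · rintro ⟨_, k, rfl⟩
    exact ⟨k, Subtype.ext (hψ k)⟩

/-- The bilinear map `(s, t) ↦ κ (s * t)` on a ring. -/
def mulPairing {R K : Type*} [Ring R] [AddCommGroup K] (κ : R →+ K) : R →+ R →+ K :=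
  AddMonoidHom.mk' (fun s => κ.comp (AddMonoidHom.mulLeft s)) fun s t => by
    ext r
    simp [add_mul]

/-- The orthogonal direct sum of two bilinear maps with the same target. -/
def orthogonalSum {R L K : Type*} [AddCommGroup R] [AddCommGroup L] [AddCommGroup K]
    (ν₁ : R →+ R →+ K) (ν₂ : L →+ L →+ K) : (R × L) →+ (R × L) →+ K :=
  AddMonoidHom.mk' (fun s => (ν₁ s.1).coprod (ν₂ s.2)) fun s t => by
    refine AddMonoidHom.ext fun r => ?_
    simp only [Prod.fst_add, Prod.snd_add, map_add, AddMonoidHom.coprod_apply,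
      AddMonoidHom.add_apply]
    abel

/-- An alternating form splits off a hyperbolic plane spanned by a pair `x`, `y` whose value
generates all values, provided that the orders of `x` and `y` divide that of the value. -/
theorem IsHyperbolicPullback.extend {M K : Type*} {L : Type u} [AddCommGroup M] [AddCommGroup L]
    [AddCommGroup K] (ω : M →+ M →+ K) (hω : ∀ u, ω u u = 0) {x y : M}
    (hxy : ∀ u v, ω u v ∈ AddSubgroup.zmultiples (ω x y))
    (hx : addOrderOf (ω x y) • x = 0) (hy : addOrderOf (ω x y) • y = 0)
    (W : AddSubgroup M) (hW : ∀ u, u ∈ W ↔ ω u y = 0 ∧ ω x u = 0)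
    (p : W →+ L × L) (ν : L →+ L →+ K)
    (hp : IsHyperbolicPullback (fun u v : W => ω u v) p ν) :
    ∃ (p' : M →+ (ULift.{u} (ZMod (addOrderOf (ω x y))) × L) ×
        (ULift.{u} (ZMod (addOrderOf (ω x y))) × L))
      (ν' : (ULift.{u} (ZMod (addOrderOf (ω x y))) × L) →+
        (ULift.{u} (ZMod (addOrderOf (ω x y))) × L) →+ K),
      IsHyperbolicPullback (fun u v => ω u v) p' ν' := by
  have hskew : ∀ u v, ω v u = -ω u v := fun u v => by
    have h := hω (u + v)
    simp only [map_add, AddMonoidHom.add_apply, hω, zero_add, add_zero] at h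
    exact eq_neg_of_add_eq_zero_left h
  set d := addOrderOf (ω x y)
  obtain ⟨ε, hε⟩ : ∃ ε : ZMod d ≃+ AddSubgroup.zmultiples (ω x y), ∀ k : ℤ, (ε k : K) = k • ω x y :=
    exists_zmod_addEquiv_zmultiples (ω x y)
  have hε' : ∀ (k : ℤ) (w : K) (hw : w ∈ AddSubgroup.zmultiples (ω x y)),
      ε.symm ⟨w, hw⟩ = k ↔ w = k • ω x y := fun k w hw => by
    rw [AddEquiv.symm_apply_eq, ← hε, Subtype.ext_iff]
  -- α u = ω(u, y)/ω(x, y) and γ u = ω(x, u)/ω(x, y) are the coordinates of u in the plane spanned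
  -- by x and y.
  let α : M →+ ZMod d :=
    ε.symm.toAddMonoidHom.comp (((ω.flip y)).codRestrict _ fun u => hxy u y)
  let γ : M →+ ZMod d :=
    ε.symm.toAddMonoidHom.comp ((ω x).codRestrict _ fun u => hxy x u)
  have hα : ∀ (u) (k : ℤ), α u = k ↔ ω u y = k • ω x y := fun u k => hε' k _ _
  have hγ : ∀ (u) (k : ℤ), γ u = k ↔ ω x u = k • ω x y := fun u k => hε' k _ _
  let X : ZMod d →+ M := ZMod.lift d ⟨zmultiplesHom M x, by simpa using hx⟩
  let Y : ZMod d →+ M := ZMod.lift d ⟨zmultiplesHom M y, by simpa using hy⟩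
  have hX : ∀ k : ℤ, X k = k • x := fun k => by simp [X]
  have hY : ∀ k : ℤ, Y k = k • y := fun k => by simp [Y]
  have hint : ∀ u, ∃ k l : ℤ, α u = k ∧ γ u = l := fun u =>
    ⟨_, _, (ZMod.intCast_surjective (α u)).choose_spec.symm,
      (ZMod.intCast_surjective (γ u)).choose_spec.symm⟩
  -- Projection to the orthogonal complement W of the plane.
  let ρ : M →+ M := AddMonoidHom.id M - X.comp α - Y.comp γ
  have hρ : ∀ u, ρ u = u - X (α u) - Y (γ u) := fun u => rfl
  have hρW : ∀ u, ρ u ∈ W := fun u => by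
    obtain ⟨k, l, hk, hl⟩ := hint u
    rw [hW, hρ, hk, hl, hX, hY]
    simp [(hα u k).1 hk, (hγ u l).1 hl, hω]
  let P : M →+ W := ρ.codRestrict W hρW
  have hP : ∀ u, (P u : M) = u - X (α u) - Y (γ u) := fun u => rfl
  let κ : ZMod d →+ K := (AddSubgroup.zmultiples (ω x y)).subtype.comp ε.toAddMonoidHom
  have hκ : ∀ k : ℤ, κ k = k • ω x y := hε
  have hκ0 : ∀ s, κ s = 0 → s = 0 := fun s hs =>
    (map_eq_zero_iff ε ε.injective).1 (Subtype.ext hs)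
  -- The lift only keeps the new summand in the universe of L.
  let τ : ULift.{u} (ZMod d) →+ ZMod d := AddEquiv.ulift.toAddMonoidHom
  let ν' : (ULift.{u} (ZMod d) × L) →+ (ULift.{u} (ZMod d) × L) →+ K :=
    orthogonalSum (mulPairing (κ.comp τ)) ν
  have hν' : ∀ s t, ν' s t = κ (s.1.down * t.1.down) + ν s.2 t.2 := fun s t => rfl
  let up : ZMod d →+ ULift.{u} (ZMod d) := AddEquiv.ulift.symm.toAddMonoidHom
  let p' : M →+ (ULift.{u} (ZMod d) × L) × (ULift.{u} (ZMod d) × L) :=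
    ((up.comp α).prod ((AddMonoidHom.fst L L).comp (p.comp P))).prod
      ((up.comp γ).prod ((AddMonoidHom.snd L L).comp (p.comp P)))
  have hp' : ∀ u, p' u = ((⟨α u⟩, (p (P u)).1), (⟨γ u⟩, (p (P u)).2)) := fun u => rfl
  refine ⟨p', ν', ?_, ⟨?_, ?_⟩, ?_⟩
  · rintro ⟨⟨⟨s⟩, a⟩, ⟨⟨t⟩, b⟩⟩
    obtain ⟨k, rfl⟩ := ZMod.intCast_surjective s
    obtain ⟨l, rfl⟩ := ZMod.intCast_surjective t
    obtain ⟨w, hw⟩ := hp.surjective (a, b)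
    obtain ⟨hw1, hw2⟩ := (hW w).1 w.2
    have h1 : α (k • x + l • y + w) = k := (hα _ _).2 (by simp [hw1, hω])
    have h2 : γ (k • x + l • y + w) = l := (hγ _ _).2 (by simp [hw2, hω])
    have h3 : P (k • x + l • y + w) = w := Subtype.ext (by rw [hP, h1, h2, hX, hY]; abel)
    exact ⟨k • x + l • y + w, by rw [hp', h1, h2, h3, hw]⟩
  · rintro ⟨⟨s⟩, a⟩ h
    have h1 : s = 0 := hκ0 s (by simpa [hν'] using h (⟨1⟩, 0))
    have h2 : a = 0 := hp.nondegenerate.1 a fun b => by simpa [hν'] using h (0, b)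
    rw [h1, h2]; rfl
  · rintro ⟨⟨s⟩, a⟩ h
    have h1 : s = 0 := hκ0 s (by simpa [hν'] using h (⟨1⟩, 0))
    have h2 : a = 0 := hp.nondegenerate.2 a fun b => by simpa [hν'] using h (0, b)
    rw [h1, h2]; rfl
  · intro u v
    obtain ⟨k, l, hk, hl⟩ := hint u
    obtain ⟨k', l', hk', hl'⟩ := hint v
    have hu : u = k • x + l • y + P u := by rw [hP, hk, hl, hX, hY]; abel
    have hv : v = k' • x + l' • y + P v := by rw [hP, hk', hl', hX, hY]; abel
    obtain ⟨hu1, hu2⟩ := (hW _).1 (P u).2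
    obtain ⟨hv1, hv2⟩ := (hW _).1 (P v).2
    have hu3 : ω (P u) x = 0 := by rw [hskew, hu2, neg_zero]
    have hv3 : ω y (P v) = 0 := by rw [hskew, hv1, neg_zero]
    have hyx := hskew x y
    have hlast := hp.apply_eq (P u) (P v)
    simp only [hν', hp']
    rw [add_sub_add_comm, ← hlast, hk, hl, hk', hl', ← Int.cast_mul, ← Int.cast_mul, hκ, hκ]
    conv_lhs => rw [hu, hv]
    simp only [map_add, AddMonoidHom.add_apply, map_zsmul, AddMonoidHom.zsmul_apply, hω, hu1, hu3,
      hv2, hv3, hyx, smul_zero, smul_neg, zero_add, add_zero, mul_smul]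
    rw [smul_comm l' k, sub_eq_add_neg, add_comm (-_)]

/-- An alternating bilinear map on a finite abelian group with values in a finite cyclic group is
the pull-back of a hyperbolic one along a surjection `M → L × L`. -/
theorem exists_isHyperbolicPullback {K : Type*} [AddCommGroup K] [IsAddCyclic K] [Finite K]
    (n : ℕ) : ∀ {M : Type u} [AddCommGroup M] [Finite M], Nat.card M = n →
    ∀ ω : M →+ M →+ K, (∀ u, ω u u = 0) →
    ∃ (L : Type u) (_ : AddCommGroup L) (p : M →+ L × L) (ν : L →+ L →+ K),
      IsHyperbolicPullback (fun u v => ω u v) p ν := by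
  induction n using Nat.strong_induction_on with
  | _ n ih =>
  intro M _ _ hn ω hω
  have hskew : ∀ u v, ω v u = -ω u v := fun u v => by
    have h := hω (u + v)
    simp only [map_add, AddMonoidHom.add_apply, hω, zero_add, add_zero] at h
    exact eq_neg_of_add_eq_zero_left h
  -- With trivial radical a hyperbolic plane splits off and induction applies to its complement;
  -- otherwise induction applies to the quotient by the radical. The latter is why p is a surjection
  -- and not an isomorphism.
  by_cases hrad : ω.ker = ⊥
  · have hinj : ∀ u, (∀ v, ω u v = 0) → u = 0 := fun u hu => by
      have : u ∈ ω.ker := by ext v; exact hu v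
      rwa [hrad, AddSubgroup.mem_bot] at this
    obtain ⟨x, y, hxy⟩ := exists_value_generating_values ω
    by_cases h0 : ω x y = 0
    · have hM : ∀ u : M, u = 0 := fun u => hinj u fun v => by
        have := hxy u v
        rwa [h0, AddSubgroup.zmultiples_zero_eq_bot, AddSubgroup.mem_bot] at this
      refine ⟨PUnit, inferInstance, 0, 0, fun _ => ⟨0, rfl⟩, ⟨fun _ _ => rfl, fun _ _ => rfl⟩, ?_⟩
      intro u v
      rw [hM u]
      simp
    -- All values are multiples of ω x y, so its order kills the form and, the radical being
    -- trivial, kills M. This makes x and y admissible for the splitting.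
    · have hkill : ∀ u : M, addOrderOf (ω x y) • u = 0 := fun u => hinj _ fun v => by
        obtain ⟨k, hk⟩ := AddSubgroup.mem_zmultiples_iff.1 (hxy u v)
        rw [map_nsmul, AddMonoidHom.nsmul_apply, ← hk, smul_comm, addOrderOf_nsmul_eq_zero,
          smul_zero]
      let W : AddSubgroup M := (ω.flip y).ker ⊓ (ω x).ker
      have hW : ∀ u, u ∈ W ↔ ω u y = 0 ∧ ω x u = 0 := fun u => Iff.rfl
      have hlt : Nat.card W < n := by
        rw [← hn]
        refine lt_of_le_of_ne (Nat.card_le_card_of_injective _ Subtype.val_injective) fun h => h0 ?_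
        have hy : y ∈ W := by rw [AddSubgroup.eq_top_of_card_eq W h]; trivial
        exact ((hW y).1 hy).2
      let ω' : W →+ W →+ K := (AddMonoidHom.compHom.flip W.subtype).comp (ω.comp W.subtype)
      obtain ⟨L, _, p, ν, hp⟩ := ih _ hlt rfl ω' fun u => hω u
      obtain ⟨p', ν', hp'⟩ := IsHyperbolicPullback.extend ω hω hxy (hkill x) (hkill y) W hW p ν hp
      exact ⟨_, inferInstance, p', ν', hp'⟩
  · have hlt : Nat.card (M ⧸ ω.ker) < n := by
      rw [← hn, AddSubgroup.card_eq_card_quotient_mul_card_addSubgroup ω.ker]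
      have h1 : 1 < Nat.card ω.ker := (AddSubgroup.one_lt_card_iff_ne_bot _).2 hrad
      have h2 : 0 < Nat.card (M ⧸ ω.ker) := Nat.card_pos
      nlinarith
    have hker : ∀ u : M, ω.ker ≤ (ω u).ker := fun u v hv => by
      have hv' : ω v = 0 := hv
      rw [AddMonoidHom.mem_ker, hskew v u, hv']
      simp
    let ω' : M ⧸ ω.ker →+ M ⧸ ω.ker →+ K :=
      QuotientAddGroup.lift ω.ker
        (AddMonoidHom.mk' (fun u => QuotientAddGroup.lift ω.ker (ω u) (hker u)) fun u v => by
          ext w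
          simp) fun u hu => by
        have hu' : ω u = 0 := hu
        ext w
        simp [hu']
    have hω' : ∀ u v : M, ω' u v = ω u v := fun u v => rfl
    obtain ⟨L, _, p, ν, hp⟩ := ih _ hlt rfl ω' fun u => by
      obtain ⟨u, rfl⟩ := QuotientAddGroup.mk_surjective u
      exact hω u
    refine ⟨L, inferInstance, p.comp (QuotientAddGroup.mk' _), ν,
      hp.surjective.comp (QuotientAddGroup.mk'_surjective _), hp.nondegenerate, fun u v => ?_⟩
    exact hp.apply_eq u v

/-! ### Commutator calculus in class two -/

section ClassTwo

variable {G : Type*} [Group G]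

theorem commutatorElement_mul_left_of_le_center
    (hG : ∀ g h : G, ⁅g, h⁆ ∈ Subgroup.center G) (g g' h : G) : ⁅g * g', h⁆ = ⁅g, h⁆ * ⁅g', h⁆ := by
  have h1 : ⁅g * g', h⁆ = g * ⁅g', h⁆ * g⁻¹ * ⁅g, h⁆ := by
    simp only [commutatorElement_def]; group
  rw [h1, Subgroup.mem_center_iff.1 (hG g' h) g, mul_inv_cancel_right]
  exact (Subgroup.mem_center_iff.1 (hG g' h) _).symm

theorem commutatorElement_mul_right_of_le_center
    (hG : ∀ g h : G, ⁅g, h⁆ ∈ Subgroup.center G) (g h h' : G) : ⁅g, h * h'⁆ = ⁅g, h⁆ * ⁅g, h'⁆ := by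
  rw [← commutatorElement_inv, commutatorElement_mul_left_of_le_center hG, mul_inv_rev,
    commutatorElement_inv, commutatorElement_inv]
  exact (Subgroup.mem_center_iff.1 (hG g h) _)

theorem commutatorElement_pow_left_of_le_center
    (hG : ∀ g h : G, ⁅g, h⁆ ∈ Subgroup.center G) (g h : G) (k : ℕ) : ⁅g ^ k, h⁆ = ⁅g, h⁆ ^ k := by
  induction k with
  | zero => simp
  | succ k ih => rw [pow_succ, pow_succ, commutatorElement_mul_left_of_le_center hG, ih]

/-- Moving g to the left past h^k costs the central factor ⁅h, g⁆^k; these costs add up to 0 + 1 + ⋯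
+ (k - 1). -/
theorem mul_pow_of_commutator_le_center
    (hG : ∀ g h : G, ⁅g, h⁆ ∈ Subgroup.center G) (g h : G) (k : ℕ) :
    (g * h) ^ k = g ^ k * h ^ k * ⁅h, g⁆ ^ k.choose 2 := by
  induction k with
  | zero => simp
  | succ k ih =>
    have hc : ∀ (m : ℕ) (x : G), x * ⁅h, g⁆ ^ m = ⁅h, g⁆ ^ m * x := fun m x =>
      Subgroup.mem_center_iff.1 (pow_mem (hG h g) m) x
    have hk : h ^ k * g = ⁅h, g⁆ ^ k * (g * h ^ k) := by
      rw [← commutatorElement_pow_left_of_le_center hG, commutatorElement_def]; group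
    have hch : (k + 1).choose 2 = k + k.choose 2 := by
      rw [Nat.choose_succ_succ' k 1, Nat.choose_one_right]
    rw [pow_succ (g * h), ih, hch, pow_succ g k, pow_succ h k]
    calc g ^ k * h ^ k * ⁅h, g⁆ ^ k.choose 2 * (g * h)
        = g ^ k * h ^ k * (g * h) * ⁅h, g⁆ ^ k.choose 2 := by
          rw [mul_assoc _ (⁅h, g⁆ ^ k.choose 2), ← hc, ← mul_assoc]
      _ = g ^ k * (h ^ k * g) * h * ⁅h, g⁆ ^ k.choose 2 := by simp only [mul_assoc]
      _ = g ^ k * g * (h ^ k * h) * ⁅h, g⁆ ^ k * ⁅h, g⁆ ^ k.choose 2 := by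
        rw [hk, ← hc]; simp only [mul_assoc]
        rw [← mul_assoc h, hc k h]; simp only [mul_assoc]
      _ = g ^ k * g * (h ^ k * h) * ⁅h, g⁆ ^ (k + k.choose 2) := by
        rw [pow_add]; simp only [mul_assoc]

/-- Expanding (hg)^e = 1 leaves ⁅g, h⁆^(e choose 2) = 1, and the exponent can be moved onto g. For
even e this controls the quadratic term in e-th powers of the twisted product. -/
theorem pow_choose_two_mem_center
    (hG : ∀ g h : G, ⁅g, h⁆ ∈ Subgroup.center G) {e : ℕ} (he : ∀ g : G, g ^ e = 1) (g : G) :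
    g ^ e.choose 2 ∈ Subgroup.center G := by
  rw [Subgroup.mem_center_iff]
  intro h
  have h1 := mul_pow_of_commutator_le_center hG h g e
  rw [he, he, he, one_mul, one_mul, ← commutatorElement_pow_left_of_le_center hG] at h1
  exact (commutatorElement_eq_one_iff_mul_comm.1 h1.symm).symm

variable {M K : Type*} [AddCommGroup M] [AddCommGroup K]

/-- The commutator of a group of class two, followed by a homomorphism `χ` on the centre, as a
bilinear map on the abelian group `G / Z(G)`. -/
theorem exists_commutator_pairing (q : G →* Multiplicative M) (hq : Function.Surjective q)
    (hker : q.ker = Subgroup.center G) (hG : ∀ g h : G, ⁅g, h⁆ ∈ Subgroup.center G)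
    (χ : Subgroup.center G →* Multiplicative K) :
    ∃ ω : M →+ M →+ K, ∀ g h, ω (q g).toAdd (q h).toAdd = (χ ⟨⁅g, h⁆, hG g h⟩).toAdd := by
  let c : G → G → K := fun g h => (χ ⟨⁅g, h⁆, hG g h⟩).toAdd
  have hl : ∀ g g' h, c (g * g') h = c g h + c g' h := fun g g' h => by
    simp only [c]
    rw [← toAdd_mul, ← map_mul]
    congr 2
    exact Subtype.ext (commutatorElement_mul_left_of_le_center hG g g' h)
  have hr : ∀ g h h', c g (h * h') = c g h + c g h' := fun g h h' => by
    simp only [c]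
    rw [← toAdd_mul, ← map_mul]
    congr 2
    exact Subtype.ext (commutatorElement_mul_right_of_le_center hG g h h')
  have hz : ∀ z ∈ Subgroup.center G, ∀ g, c z g = 0 ∧ c g z = 0 := fun z hz g => by
    have h1 : ⁅z, g⁆ = 1 :=
      commutatorElement_eq_one_iff_mul_comm.2 (Subgroup.mem_center_iff.1 hz g).symm
    have h2 : ⁅g, z⁆ = 1 :=
      commutatorElement_eq_one_iff_mul_comm.2 (Subgroup.mem_center_iff.1 hz g)
    have h3 : (⟨⁅z, g⁆, hG z g⟩ : Subgroup.center G) = 1 := Subtype.ext h1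
    have h4 : (⟨⁅g, z⁆, hG g z⟩ : Subgroup.center G) = 1 := Subtype.ext h2
    simp [c, h3, h4]
  have hwd : ∀ g g' h h', q g = q g' → q h = q h' → c g h = c g' h' := fun g g' h h' h1 h2 => by
    have h1' : g'⁻¹ * g ∈ Subgroup.center G := by
      rw [← hker, MonoidHom.mem_ker, map_mul, map_inv, h1, inv_mul_cancel]
    have h2' : h'⁻¹ * h ∈ Subgroup.center G := by
      rw [← hker, MonoidHom.mem_ker, map_mul, map_inv, h2, inv_mul_cancel]
    rw [← mul_inv_cancel_left g' g, hl, (hz _ h1' _).1, add_zero,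
      ← mul_inv_cancel_left h' h, hr, (hz _ h2' _).2, add_zero]
  let s : M → G := fun m => Function.surjInv hq (Multiplicative.ofAdd m)
  have hs : ∀ m, q (s m) = Multiplicative.ofAdd m := fun m => Function.surjInv_eq hq _
  refine ⟨AddMonoidHom.mk' (fun m => AddMonoidHom.mk' (fun m' => c (s m) (s m')) fun x y => ?_)
    fun x y => ?_, fun g h => ?_⟩
  · rw [← hr]
    exact hwd _ _ _ _ rfl (by simp only [map_mul, hs, ofAdd_add])
  · ext w
    change c _ _ = c _ _ + c _ _
    rw [← hl]
    exact hwd _ _ _ _ (by simp only [map_mul, hs, ofAdd_add]) rfl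
  · exact hwd _ _ _ _ (hs _) (hs _)

end ClassTwo

/-! ### Twisted products and the extension of central characters -/

/-- The set `G × K` with the multiplication `(g, c) (h, d) = (g h, c + d - β (q g, q h))`. -/
@[ext]
structure TwistedProduct {G M K : Type*} [Group G] [AddCommGroup M] [AddCommGroup K]
    (q : G →* Multiplicative M) (β : M →+ M →+ K) where
  fst : G
  snd : K

namespace TwistedProduct

variable {G M K : Type*} [Group G] [AddCommGroup M] [AddCommGroup K]
  {q : G →* Multiplicative M} {β : M →+ M →+ K}

instance : Group (TwistedProduct q β) where
  mul x y := ⟨x.fst * y.fst, x.snd + y.snd - β (q x.fst).toAdd (q y.fst).toAdd⟩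
  one := ⟨1, 0⟩
  inv x := ⟨x.fst⁻¹, -x.snd - β (q x.fst).toAdd (q x.fst).toAdd⟩
  mul_assoc x y z := by
    change TwistedProduct.mk (x.fst * y.fst * z.fst)
        (x.snd + y.snd - β (q x.fst).toAdd (q y.fst).toAdd + z.snd -
          β (q (x.fst * y.fst)).toAdd (q z.fst).toAdd) =
      TwistedProduct.mk (x.fst * (y.fst * z.fst))
        (x.snd + (y.snd + z.snd - β (q y.fst).toAdd (q z.fst).toAdd) -
          β (q x.fst).toAdd (q (y.fst * z.fst)).toAdd)
    simp only [mk.injEq, map_mul, toAdd_mul, map_add, AddMonoidHom.add_apply]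
    exact ⟨mul_assoc _ _ _, by abel⟩
  one_mul x := by
    change TwistedProduct.mk (1 * x.fst) (0 + x.snd - β (q 1).toAdd (q x.fst).toAdd) = x
    simp
  mul_one x := by
    change TwistedProduct.mk (x.fst * 1) (x.snd + 0 - β (q x.fst).toAdd (q 1).toAdd) = x
    simp
  inv_mul_cancel x := by
    change TwistedProduct.mk (x.fst⁻¹ * x.fst) (-x.snd - β (q x.fst).toAdd (q x.fst).toAdd + x.snd -
      β (q x.fst⁻¹).toAdd (q x.fst).toAdd) = TwistedProduct.mk 1 0
    simp only [inv_mul_cancel, map_inv, toAdd_inv, map_neg, AddMonoidHom.neg_apply, mk.injEq,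
      true_and]
    abel

theorem mk_mul_mk (g h : G) (c d : K) :
    (⟨g, c⟩ * ⟨h, d⟩ : TwistedProduct q β) = ⟨g * h, c + d - β (q g).toAdd (q h).toAdd⟩ := rfl

theorem one_eq : (1 : TwistedProduct q β) = ⟨1, 0⟩ := rfl

theorem mk_pow (g : G) (c : K) (k : ℕ) : (⟨g, c⟩ ^ k : TwistedProduct q β) =
    ⟨g ^ k, k • c - k.choose 2 • β (q g).toAdd (q g).toAdd⟩ := by
  induction k with
  | zero => simp [one_eq]
  | succ k ih =>
    have hch : (k + 1).choose 2 = k + k.choose 2 := by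
      rw [Nat.choose_succ_succ' k 1, Nat.choose_one_right]
    rw [pow_succ, ih, mk_mul_mk, hch, add_smul k (k.choose 2),
      succ_nsmul, map_pow, toAdd_pow, map_nsmul, AddMonoidHom.nsmul_apply, pow_succ]
    congr 1
    abel

instance [Finite G] [Finite K] : Finite (TwistedProduct q β) :=
  Finite.of_injective (fun x => (x.fst, x.snd)) fun _ _ h =>
    TwistedProduct.ext (Prod.mk.inj h).1 (Prod.mk.inj h).2

end TwistedProduct

/-- If the commutator pairing of a class-two group of exponent dividing `e`, pushed forward along a
character `χ` of the centre into a cyclic group of order `e`, is the antisymmetrization of `β`, then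
`χ` extends to a map `φ` on the group whose coboundary is `β`. -/
theorem exists_extension_with_coboundary {G M K : Type*} [Group G] [Finite G] [AddCommGroup M]
    [AddCommGroup K] [IsAddCyclic K] {e : ℕ} [NeZero e] (hK : Nat.card K = e)
    (q : G →* Multiplicative M) (hker : q.ker = Subgroup.center G)
    (hG : ∀ g h : G, ⁅g, h⁆ ∈ Subgroup.center G) (he : ∀ g : G, g ^ e = 1)
    (χ : Subgroup.center G →* Multiplicative K) (β : M →+ M →+ K)
    (hβ : ∀ g h, β (q g).toAdd (q h).toAdd - β (q h).toAdd (q g).toAdd =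
      (χ ⟨⁅g, h⁆, hG g h⟩).toAdd) :
    ∃ φ : G → K, (∀ g h, φ (g * h) = φ g + β (q g).toAdd (q h).toAdd + φ h) ∧
      ∀ z : Subgroup.center G, φ z = (χ z).toAdd := by
  have hq1 : ∀ z ∈ Subgroup.center G, q z = 1 := fun z hz => by
    rwa [← hker, MonoidHom.mem_ker] at hz
  have : Finite K := Nat.finite_of_card_ne_zero (hK ▸ NeZero.ne e)
  -- Dividing by the graph of -χ identifies (z, 0) with (1, χ z), so a retraction onto K will
  -- automatically restrict to χ on the centre.
  let ι : Subgroup.center G →* TwistedProduct q β :=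
    { toFun := fun z => ⟨z, -(χ z).toAdd⟩
      map_one' := by simp [TwistedProduct.one_eq]
      map_mul' := fun z w => by
        rw [TwistedProduct.mk_mul_mk, hq1 z z.2]
        simp [add_comm] }
  have hι : ∀ z, ι z = ⟨z, -(χ z).toAdd⟩ := fun z => rfl
  have hcen : ι.range ≤ Subgroup.center (TwistedProduct q β) := by
    rintro _ ⟨z, rfl⟩
    rw [Subgroup.mem_center_iff]
    rintro ⟨h, d⟩
    rw [hι, TwistedProduct.mk_mul_mk, TwistedProduct.mk_mul_mk, hq1 z z.2,
      Subgroup.mem_center_iff.1 z.2 h]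
    simp [add_comm]
  have hN : ι.range.Normal := ⟨fun n hn g => by
    rw [Subgroup.mem_center_iff.1 (hcen hn) g, mul_inv_cancel_right]; exact hn⟩
  let E := TwistedProduct q β ⧸ ι.range
  let π : TwistedProduct q β →* E := QuotientGroup.mk' _
  have hπ : ∀ z, π (ι z) = 1 := fun z => (QuotientGroup.eq_one_iff _).2 ⟨z, rfl⟩
  have hcomm : ∀ x y : E, x * y = y * x := fun x y => by
    obtain ⟨⟨g, c⟩, rfl⟩ := QuotientGroup.mk'_surjective _ x
    obtain ⟨⟨h, d⟩, rfl⟩ := QuotientGroup.mk'_surjective _ y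
    -- By `hβ`, commutators in the twisted product lie on the graph, so the quotient is abelian.
    have key : (⟨g, c⟩ * ⟨h, d⟩ : TwistedProduct q β) =
        ι ⟨⁅g, h⁆, hG g h⟩ * (⟨h, d⟩ * ⟨g, c⟩) := by
      rw [hι, TwistedProduct.mk_mul_mk, TwistedProduct.mk_mul_mk, TwistedProduct.mk_mul_mk,
        hq1 _ (hG g h), ← hβ]
      ext
      · simp [commutatorElement_def]
      · simp only [toAdd_one, map_zero, AddMonoidHom.zero_apply]; abel
    change π _ * π _ = π _ * π _
    rw [← map_mul, key, map_mul, hπ, one_mul, map_mul]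
  let _ : CommGroup E := { (inferInstance : Group E) with mul_comm := hcomm }
  have hM : ∀ g : G, e.choose 2 • (q g).toAdd = 0 := fun g => by
    rw [← toAdd_pow, ← map_pow, hq1 _ (pow_choose_two_mem_center hG he g), toAdd_one]
  have hE : ∀ x : E, x ^ e = 1 := fun x => by
    obtain ⟨⟨g, c⟩, rfl⟩ := QuotientGroup.mk'_surjective _ x
    change π _ ^ e = 1
    rw [← map_pow, TwistedProduct.mk_pow, he, ← map_nsmul, hM, map_zero, sub_zero, ← hK,
      card_nsmul_eq_zero', ← TwistedProduct.one_eq, map_one]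
  let f : Multiplicative K →* E := π.comp
    { toFun := fun k => (⟨1, k.toAdd⟩ : TwistedProduct q β)
      map_one' := rfl
      map_mul' := fun k l => by simp [TwistedProduct.mk_mul_mk] }
  -- K survives in the quotient: a point (1, k) of the graph lies over z = 1, which forces k = 0.
  have hf : Function.Injective f := by
    rw [injective_iff_map_eq_one]
    intro k hk
    obtain ⟨z, hz⟩ := (QuotientGroup.eq_one_iff _).1 hk
    rw [hι] at hz
    obtain ⟨h1, h2⟩ := TwistedProduct.ext_iff.1 hz
    have h3 : z = 1 := Subtype.ext h1
    have h4 : -(χ z).toAdd = k.toAdd := h2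
    rw [h3, map_one, toAdd_one, neg_zero] at h4
    exact h4.symm
  obtain ⟨r, hr⟩ := exists_retraction_of_injective hK hE f hf
  have hfk : ∀ k : K, π ⟨1, k⟩ = f (Multiplicative.ofAdd k) := fun k => rfl
  refine ⟨fun g => (r (π ⟨g, 0⟩)).toAdd, fun g h => ?_, fun z => ?_⟩
  -- The factor (1, β) cancels the twist -β in the product; applying r turns this into the
  -- coboundary identity with sign +β.
  · have key : (⟨g * h, 0⟩ : TwistedProduct q β) =
        ⟨g, 0⟩ * ⟨1, β (q g).toAdd (q h).toAdd⟩ * ⟨h, 0⟩ := by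
      simp [TwistedProduct.mk_mul_mk]
    simp only [key, map_mul, toAdd_mul, hfk, hr, toAdd_ofAdd]
  · have key : (⟨z, 0⟩ : TwistedProduct q β) = ι z * ⟨1, (χ z).toAdd⟩ := by
      rw [hι, TwistedProduct.mk_mul_mk]
      simp
    simp only [key, map_mul, hπ, one_mul, hfk, hr, toAdd_ofAdd]

/-! ### Heisenberg groups and the coordinatewise embedding -/

theorem HeisenbergGroup.mul_def {A B C : Type*} [AddCommGroup A] [AddCommGroup B] [AddCommGroup C]
    {μ : A →+ B →+ C} (x y : HeisenbergGroup μ) :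
    x * y = ⟨x.fst + y.fst, x.snd + y.snd, x.cen + μ x.fst y.snd + y.cen⟩ := rfl

theorem HeisenbergGroup.extension_isNondegenerate {A B C : Type*} [AddCommGroup A]
    [AddCommGroup B] [AddCommGroup C] {μ : A →+ B →+ C} (hμ : IsNondegenerateBilin μ) :
    (HeisenbergGroup.extension μ).IsNondegenerate := by
  have hle : (HeisenbergGroup.extension μ).inl.range ≤ Subgroup.center (HeisenbergGroup μ) := by
    rintro _ ⟨c, rfl⟩
    rw [Subgroup.mem_center_iff]
    rintro ⟨a, b, d⟩
    change HeisenbergGroup.mk (a + 0) (b + 0) (d + μ a 0 + c.toAdd) =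
      HeisenbergGroup.mk (0 + a) (0 + b) (c.toAdd + μ 0 b + d)
    simp [add_comm]
  refine ⟨⟨hle, mul_comm⟩, le_antisymm hle fun x hx => ?_⟩
  -- The two sides depend on independent variables, so both vanish identically.
  have key : ∀ a b, μ a x.snd = μ x.fst b := fun a b => by
    have h := congrArg HeisenbergGroup.cen (Subgroup.mem_center_iff.1 hx ⟨a, b, 0⟩)
    simp only [HeisenbergGroup.mul_def, zero_add, add_zero] at h
    rw [add_comm] at h
    exact add_left_cancel h
  have h1 : x.fst = 0 := hμ.1 _ fun b => by rw [← key 0 b]; simp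
  have h2 : x.snd = 0 := hμ.2 _ fun a => by rw [key a 0]; simp
  exact ⟨Multiplicative.ofAdd x.cen, HeisenbergGroup.ext h1.symm h2.symm rfl⟩

theorem HeisenbergGroup.natCard {A B C : Type*} [AddCommGroup A] [AddCommGroup B]
    [AddCommGroup C] (μ : A →+ B →+ C) :
    Nat.card (HeisenbergGroup μ) = Nat.card A * Nat.card B * Nat.card C := by
  rw [mul_assoc, ← Nat.card_prod, ← Nat.card_prod]
  exact Nat.card_congr ⟨fun x => (x.fst, x.snd, x.cen), fun x => ⟨x.1, x.2.1, x.2.2⟩,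
    fun _ => rfl, fun _ => rfl⟩

theorem AddGroup.rank_additive (H : Type*) [Group H] [Finite H] :
    AddGroup.rank (Additive H) = Group.rank H := by
  apply le_antisymm
  · obtain ⟨S, hS, hgen⟩ := Group.rank_spec H
    rw [← hS, ← Finset.card_map Additive.ofMul.toEmbedding]
    refine AddGroup.rank_le (S := S.map Additive.ofMul.toEmbedding) ?_
    have := congrArg Subgroup.toAddSubgroup hgen
    rw [Subgroup.toAddSubgroup_closure] at this
    rw [Finset.coe_map]
    refine Eq.trans ?_ this
    congr 1
    ext x
    simp
  · obtain ⟨S, hS, hgen⟩ := AddGroup.rank_spec (Additive H)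
    rw [← hS, ← Finset.card_map Additive.toMul.toEmbedding]
    refine Group.rank_le (S := S.map Additive.toMul.toEmbedding) ?_
    have := congrArg AddSubgroup.toSubgroup' hgen
    rw [AddSubgroup.toSubgroup'_closure] at this
    rw [Finset.coe_map]
    refine Eq.trans ?_ this
    congr 1
    ext x
    simp

/-- The restriction to the images of the two component maps of the product of a family of bilinear
maps. -/
def piPairing {ι M : Type*} {L : ι → Type*} {K : Type*} [AddCommGroup M]
    [∀ i, AddCommGroup (L i)] [AddCommGroup K] (ν : ∀ i, L i →+ L i →+ K)
    (a b : M →+ ∀ i, L i) : a.range →+ b.range →+ (ι → K) :=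
  AddMonoidHom.mk' (fun x => AddMonoidHom.mk' (fun y i => ν i (x.1 i) (y.1 i)) fun y y' => by
    funext i
    exact map_add (ν i (x.1 i)) _ _) fun x x' => by
      ext y i
      exact DFunLike.congr_fun (map_add (ν i) _ _) _

section Embedding

variable {ι : Type*} {M K : Type*} {L : ι → Type*} [AddCommGroup M] [∀ i, AddCommGroup (L i)]
  [AddCommGroup K] (p : ∀ i, M →+ L i × L i) (ν : ∀ i, L i →+ L i →+ K)

/-- The first components of a family of maps `M → L i × L i`. -/
def piFst : M →+ ∀ i, L i := AddMonoidHom.pi fun i => (AddMonoidHom.fst _ _).comp (p i)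

/-- The second components of a family of maps `M → L i × L i`. -/
def piSnd : M →+ ∀ i, L i := AddMonoidHom.pi fun i => (AddMonoidHom.snd _ _).comp (p i)

variable {p ν}

/-- Non-degeneracy is tested one coordinate at a time, so each p i must be onto, but the family need
not be jointly onto. -/
theorem piPairing_isNondegenerateBilin (hp : ∀ i, Function.Surjective (p i))
    (hν : ∀ i, IsNondegenerateBilin (ν i)) :
    IsNondegenerateBilin (piPairing ν (piFst p) (piSnd p)) := by
  constructor
  · rintro ⟨x, hx⟩ h
    refine Subtype.ext (funext fun i => (hν i).1 _ fun l => ?_)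
    obtain ⟨m, hm⟩ := hp i (0, l)
    have := congrFun (h ⟨_, m, rfl⟩) i
    change ν i (x i) (p i m).2 = 0 at this
    rwa [hm] at this
  · rintro ⟨x, hx⟩ h
    refine Subtype.ext (funext fun i => (hν i).2 _ fun l => ?_)
    obtain ⟨m, hm⟩ := hp i (l, 0)
    have := congrFun (h ⟨_, m, rfl⟩) i
    change ν i (p i m).1 (x i) = 0 at this
    rwa [hm] at this

variable (p ν) in
/-- The coordinatewise embedding of the Heisenberg extension of `piPairing` into the product of the
Heisenberg extensions of its coordinates. -/
def piPairingMorphism : (HeisenbergGroup.extension (piPairing ν (piFst p) (piSnd p))).Morphism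
    (GroupExtension.pi fun i => HeisenbergGroup.extension (ν i)) where
  left :=
    { toFun := fun c i => Multiplicative.ofAdd (c.toAdd i)
      map_one' := rfl
      map_mul' := fun _ _ => rfl }
  mid :=
    { toFun := fun x i => ⟨x.fst.1 i, x.snd.1 i, x.cen i⟩
      map_one' := rfl
      map_mul' := fun _ _ => rfl }
  right :=
    { toFun := fun x i => Multiplicative.ofAdd (x.toAdd.1.1 i, x.toAdd.2.1 i)
      map_one' := rfl
      map_mul' := fun _ _ => rfl }
  mid_inl _ := rfl
  rightHom_mid _ := rfl

theorem piPairingMorphism_isMono : (piPairingMorphism p ν).IsMono := by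
  refine ⟨fun c d h => ?_, fun x y h => ?_, fun x y h => ?_⟩
  · exact funext fun i => congrFun h i
  · have hi : ∀ i, _ := fun i => HeisenbergGroup.ext_iff.1 (congrFun h i)
    exact HeisenbergGroup.ext (Subtype.ext (funext fun i => (hi i).1))
      (Subtype.ext (funext fun i => (hi i).2.1)) (funext fun i => (hi i).2.2)
  · have hi : ∀ i, _ := fun i => Prod.ext_iff.1 (congrFun h i)
    exact Prod.ext (Subtype.ext (funext fun i => (hi i).1)) (Subtype.ext (funext fun i => (hi i).2))

end Embedding

/-! ### Exponents and the assembly of the embedding -/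

theorem AddMonoid.exponent_dvd_of_surjective {A B : Type*} [AddCommGroup A] [AddCommGroup B]
    (f : A →+ B) (hf : Function.Surjective f) : AddMonoid.exponent B ∣ AddMonoid.exponent A := by
  rw [AddMonoid.exponent_dvd_iff_forall_nsmul_eq_zero]
  intro b
  obtain ⟨a, rfl⟩ := hf b
  rw [← map_nsmul, AddMonoid.exponent_nsmul_eq_zero, map_zero]

theorem isMulCommutative_quotient_center_of_nilpotencyClass_le_two {G : Type*} [Group G]
    [Group.IsNilpotent G] (hG : Group.nilpotencyClass G ≤ 2) :
    IsMulCommutative (G ⧸ Subgroup.center G) := by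
  rw [← Group.IsNilpotent.nilpotencyClass_le_one_iff, Group.nilpotencyClass_quotient_center]
  omega

/-- If k kills G', then ⁅g^k, h⁆ = ⁅g, h⁆^k = 1, so g^k is central. -/
theorem exponent_quotient_center_dvd_exponent_commutator {G : Type*} [Group G]
    (hG : ∀ g h : G, ⁅g, h⁆ ∈ Subgroup.center G) :
    Monoid.exponent (G ⧸ Subgroup.center G) ∣ Monoid.exponent (commutator G) := by
  rw [Monoid.exponent_dvd_iff_forall_pow_eq_one]
  intro x
  obtain ⟨g, rfl⟩ := QuotientGroup.mk_surjective x
  rw [← QuotientGroup.mk_pow, QuotientGroup.eq_one_iff, Subgroup.mem_center_iff]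
  intro h
  refine (commutatorElement_eq_one_iff_mul_comm.1 ?_).symm
  rw [commutatorElement_pow_left_of_le_center hG]
  have hmem : ⁅g, h⁆ ∈ commutator G :=
    Subgroup.commutator_mem_commutator (Subgroup.mem_top g) (Subgroup.mem_top h)
  exact congrArg Subtype.val (Monoid.pow_exponent_eq_one (⟨⁅g, h⁆, hmem⟩ : commutator G))

theorem theorem4 {G : Type u} [Group G] [Finite G] [Group.IsNilpotent G]
    (hG : Group.nilpotencyClass G ≤ 2) :
    ∃ (A B C : Type u) (_ : AddCommGroup A) (_ : AddCommGroup B) (_ : AddCommGroup C)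
      (_ : Finite A) (_ : Finite B) (_ : Finite C)
      (A' C' : Fin (Group.rank (Subgroup.center G)) → Type u)
      (_ : ∀ i, AddCommGroup (A' i)) (_ : ∀ i, AddCommGroup (C' i))
      (_ : ∀ i, Finite (A' i)) (_ : ∀ i, Finite (C' i))
      (μ : A →+ B →+ C) (μ' : ∀ i, A' i →+ A' i →+ C' i)
      (f : (GroupExtension.ofCenter G).Morphism (HeisenbergGroup.extension μ))
      (h : (HeisenbergGroup.extension μ).Morphism
        (GroupExtension.pi fun i => HeisenbergGroup.extension (μ' i))),
      -- non-degeneracy of the bilinear maps and of the Heisenberg groups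
      (IsNondegenerateBilin μ ∧ (HeisenbergGroup.extension μ).IsNondegenerate) ∧
      (∀ i, IsNondegenerateBilin (μ' i) ∧ (HeisenbergGroup.extension (μ' i)).IsNondegenerate) ∧
      -- both morphisms of extensions are monomorphisms
      f.IsMono ∧ h.IsMono ∧
      -- no new primes appear
      (∀ p : ℕ, p.Prime →
        (p ∣ Nat.card A ∨ p ∣ Nat.card B ∨ p ∣ Nat.card C ∨ p ∣ Nat.card (A × B) ∨
          p ∣ Nat.card (HeisenbergGroup μ) ∨
          (∃ i, p ∣ Nat.card (A' i) ∨ p ∣ Nat.card (C' i) ∨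
            p ∣ Nat.card (HeisenbergGroup (μ' i))) ∨
          p ∣ Nat.card (∀ i, C' i) ∨ p ∣ Nat.card (∀ i, HeisenbergGroup (μ' i)) ∨
          p ∣ Nat.card (∀ i, A' i × A' i)) →
        p ∣ Nat.card G) ∧
      -- numbers of generators
      AddGroup.rank A ≤ Group.rank (G ⧸ Subgroup.center G) ∧
      AddGroup.rank B ≤ Group.rank (G ⧸ Subgroup.center G) ∧
      (∀ i, AddGroup.rank (A' i × A' i) ≤ Group.rank (G ⧸ Subgroup.center G)) ∧
      AddGroup.rank C = Group.rank (Subgroup.center G) ∧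
      (∀ i, IsAddCyclic (C' i) ∧ AddGroup.rank (C' i) ≤ 1 ∧
        AddGroup.rank (C' i) ≤ AddGroup.rank C) ∧
      -- exponents
      Monoid.exponent (G ⧸ Subgroup.center G) ∣ AddMonoid.exponent (A × B) ∧
      AddMonoid.exponent (A × B) ∣ Monoid.exponent (commutator G) ∧
      Monoid.exponent (commutator G) ∣ Monoid.exponent (Subgroup.center G) ∧
      Monoid.exponent (Subgroup.center G) ∣ AddMonoid.exponent C ∧
      AddMonoid.exponent C ∣ Monoid.exponent G := by
  classical
  have hcomm := isMulCommutative_quotient_center_of_nilpotencyClass_le_two hG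
  let _ : CommGroup (G ⧸ Subgroup.center G) :=
    { (inferInstance : Group (G ⧸ Subgroup.center G)) with mul_comm := hcomm.is_comm.comm }
  have hcen : ∀ g h : G, ⁅g, h⁆ ∈ Subgroup.center G := fun g h => by
    rw [← QuotientGroup.eq_one_iff, ← QuotientGroup.mk'_apply, map_commutatorElement,
      commutatorElement_eq_one_iff_mul_comm]
    exact mul_comm _ _
  let M := Additive (G ⧸ Subgroup.center G)
  let q : G →* Multiplicative M :=
    { toFun := fun g => Multiplicative.ofAdd (Additive.ofMul (g : G ⧸ Subgroup.center G))
      map_one' := rfl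
      map_mul' := fun _ _ => rfl }
  have hq : Function.Surjective q := QuotientGroup.mk_surjective
  have hker : q.ker = Subgroup.center G := QuotientGroup.ker_mk' _
  set e := Monoid.exponent G with he
  have : NeZero e := ⟨Monoid.exponent_ne_zero_of_finite⟩
  have hpow : ∀ g : G, g ^ e = 1 := Monoid.pow_exponent_eq_one
  let K := ULift.{u} (ZMod e)
  have hK : Nat.card K = e := by rw [Nat.card_ulift, Nat.card_zmod]
  have : IsAddCyclic K :=
    isAddCyclic_of_surjective (AddEquiv.ulift.symm : ZMod e ≃+ K) AddEquiv.ulift.symm.surjective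
  have hKe : ∀ k : K, e • k = 0 := fun k => by
    have h : Nat.card K • k = 0 := card_nsmul_eq_zero'
    rwa [hK] at h
  obtain ⟨χ, hχ⟩ : ∃ χ : Fin (Group.rank (Subgroup.center G)) →
      Subgroup.center G →* Multiplicative K, ∀ z, (∀ i, χ i z = 1) → z = 1 := by
    let _ : CommGroup (Subgroup.center G) :=
      { (inferInstance : Group (Subgroup.center G)) with
        mul_comm := fun z w => Subtype.ext (Subgroup.mem_center_iff.1 w.2 z) }
    exact exists_jointly_injective_characters hK fun z => Subtype.ext (hpow z)
  choose ω hω using fun i => exists_commutator_pairing q hq hker hcen (χ i)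
  have hωalt : ∀ i u, ω i u u = 0 := fun i u => by
    obtain ⟨g, hg⟩ := hq (Multiplicative.ofAdd u)
    have h := hω i g g
    have h1 : (⟨⁅g, g⁆, hcen g g⟩ : Subgroup.center G) = 1 := Subtype.ext (commutatorElement_self g)
    rwa [hg, h1, map_one] at h
  choose L instL p ν hp using fun i => exists_isHyperbolicPullback _ rfl (ω i) (hωalt i)
  let β : ∀ i, M →+ M →+ K := fun i => AddMonoidHom.mk'
    (fun x => (ν i (p i x).1).comp ((AddMonoidHom.snd _ _).comp (p i))) fun x y => by
      ext z
      simp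
  have hβ : ∀ i x y, β i x y = ν i (p i x).1 (p i y).2 := fun _ _ _ => rfl
  choose φ hφ hφχ using fun i => exists_extension_with_coboundary hK q hker hcen hpow (χ i) (β i)
    fun g h => by rw [← hω, hβ, hβ]; exact ((hp i).apply_eq _ _).symm
  have hfin : ∀ i, Finite (L i) := fun i =>
    Finite.of_surjective _ (Prod.fst_surjective.comp (hp i).surjective)
  have hμ : IsNondegenerateBilin (piPairing ν (piFst p) (piSnd p)) :=
    piPairing_isNondegenerateBilin (fun i => (hp i).surjective) fun i => (hp i).nondegenerate
  let f : (GroupExtension.ofCenter G).Morphism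
      (HeisenbergGroup.extension (piPairing ν (piFst p) (piSnd p))) :=
    { left :=
        { toFun := fun z => Multiplicative.ofAdd fun i => (χ i z).toAdd
          map_one' := by simp; rfl
          map_mul' := fun z w => by simp; rfl }
      mid :=
        { toFun := fun g => ⟨(piFst p).rangeRestrict (q g).toAdd,
            (piSnd p).rangeRestrict (q g).toAdd, fun i => φ i g⟩
          map_one' := by
            refine HeisenbergGroup.ext (map_zero _) (map_zero _) (funext fun i => ?_)
            have h := hφχ i 1
            rw [map_one] at h
            exact h
          map_mul' := fun g h => HeisenbergGroup.ext
            (map_add (piFst p).rangeRestrict (q g).toAdd (q h).toAdd)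
            (map_add (piSnd p).rangeRestrict (q g).toAdd (q h).toAdd)
            (funext fun i => hφ i g h) }
      right :=
        { toFun := fun x => Multiplicative.ofAdd ((piFst p).rangeRestrict (Additive.ofMul x),
            (piSnd p).rangeRestrict (Additive.ofMul x))
          map_one' := congrArg Multiplicative.ofAdd (Prod.ext (map_zero _) (map_zero _))
          map_mul' := fun x y =>
            congrArg Multiplicative.ofAdd (Prod.ext (map_add _ _ _) (map_add _ _ _)) }
      mid_inl := fun z => by
        have hz : q z = 1 := by
          rw [← MonoidHom.mem_ker, hker]; exact z.2
        refine HeisenbergGroup.ext ?_ ?_ (funext fun i => hφχ i z)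
        · change (piFst p).rangeRestrict (q z).toAdd = 0
          rw [hz, toAdd_one, map_zero]
        · change (piSnd p).rangeRestrict (q z).toAdd = 0
          rw [hz, toAdd_one, map_zero]
      rightHom_mid := fun g => rfl }
  have hleft : Function.Injective f.left := by
    rw [injective_iff_map_eq_one]
    exact fun z hz => hχ z fun i => congrFun hz i
  -- If every p i kills the class of g, then every χ i kills ⁅g, h⁆ for all h, so g is central.
  have hright : Function.Injective f.right := by
    rw [injective_iff_map_eq_one]
    intro x hx
    obtain ⟨g, rfl⟩ := QuotientGroup.mk_surjective x
    have h1 : ∀ i, (p i (q g).toAdd).1 = 0 := fun i =>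
      congrFun (congrArg Subtype.val (congrArg Prod.fst hx)) i
    have h2 : ∀ i, (p i (q g).toAdd).2 = 0 := fun i =>
      congrFun (congrArg Subtype.val (congrArg Prod.snd hx)) i
    rw [QuotientGroup.eq_one_iff, Subgroup.mem_center_iff]
    intro h
    refine (commutatorElement_eq_one_iff_mul_comm.1 ?_).symm
    refine congrArg Subtype.val (hχ ⟨⁅g, h⁆, hcen g h⟩ fun i => ?_)
    have h3 := (hp i).apply_eq (q g).toAdd (q h).toAdd
    rw [h1, h2, map_zero, map_zero, AddMonoidHom.zero_apply, sub_zero] at h3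
    exact (hω i g h).symm.trans h3
  have hmid : Function.Injective f.mid := by
    rw [injective_iff_map_eq_one]
    intro g hg
    have h1 : f.right (g : G ⧸ Subgroup.center G) = 1 := by
      have := f.rightHom_mid g
      rw [hg, map_one] at this
      exact this.symm
    have h2 : g ∈ Subgroup.center G := by
      rw [← QuotientGroup.eq_one_iff]
      exact hright (h1.trans (map_one _).symm)
    have h3 : (⟨g, h2⟩ : Subgroup.center G) = 1 := by
      apply hleft
      apply (HeisenbergGroup.extension (piPairing ν (piFst p) (piSnd p))).inl_injective
      rw [← f.mid_inl, map_one, map_one]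
      exact hg
    exact congrArg Subtype.val h3
  have hcardM : Nat.card M ∣ Nat.card G := Subgroup.card_quotient_dvd_card _
  have hrankM : AddGroup.rank M = Group.rank (G ⧸ Subgroup.center G) := AddGroup.rank_additive _
  have hexpM : AddMonoid.exponent M = Monoid.exponent (G ⧸ Subgroup.center G) :=
    AddMonoid.exponent_additive
  have hA := (piFst p).rangeRestrict_surjective
  have hB := (piSnd p).rangeRestrict_surjective
  have hC : AddGroup.rank (Fin (Group.rank (Subgroup.center G)) → K) =
      Group.rank (Subgroup.center G) := by
    -- For trivial K the homocyclic rank formula fails, but then the centre embeds in a trivial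
    -- group and both ranks are 0.
    by_cases h : Nontrivial K
    · exact rank_pi_cyclic _
    · have hsub : Subsingleton K := not_nontrivial_iff_subsingleton.1 h
      have : Subsingleton (Subgroup.center G) :=
        hleft.subsingleton
      rw [AddGroup.rank_eq_zero, Group.rank_eq_zero]
  have hK1 : AddGroup.rank K ≤ 1 := by
    obtain ⟨g, hg⟩ := IsAddCyclic.exists_generator (α := K)
    refine (AddGroup.rank_le (S := {g}) ?_).trans (Finset.card_singleton g).le
    rw [Finset.coe_singleton, ← AddSubgroup.zmultiples_eq_closure]
    exact eq_top_iff.2 fun x _ => hg x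
  refine ⟨(piFst p).range, (piSnd p).range, Fin (Group.rank (Subgroup.center G)) → K,
    inferInstance, inferInstance, inferInstance, Finite.of_surjective _ hA,
    Finite.of_surjective _ hB, inferInstance, L, fun _ => K, instL, inferInstance, hfin,
    inferInstance, piPairing ν (piFst p) (piSnd p), ν, f, piPairingMorphism p ν,
    ⟨hμ, HeisenbergGroup.extension_isNondegenerate hμ⟩,
    fun i => ⟨(hp i).nondegenerate, HeisenbergGroup.extension_isNondegenerate (hp i).nondegenerate⟩,
    ⟨hleft, hmid, hright⟩, piPairingMorphism_isMono, ?_, ?_, ?_, ?_, hC, ?_, ?_, ?_, ?_, ?_, ?_⟩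
  · intro r hr
    have hr' := hr.prime
    have cA : r ∣ Nat.card (piFst p).range → r ∣ Nat.card G := fun h =>
      h.trans ((AddSubgroup.card_dvd_of_surjective _ hA).trans hcardM)
    have cB : r ∣ Nat.card (piSnd p).range → r ∣ Nat.card G := fun h =>
      h.trans ((AddSubgroup.card_dvd_of_surjective _ hB).trans hcardM)
    have cK : r ∣ Nat.card K → r ∣ Nat.card G := fun h =>
      h.trans (hK ▸ Group.exponent_dvd_nat_card)
    have cC : r ∣ Nat.card (Fin (Group.rank (Subgroup.center G)) → K) → r ∣ Nat.card G := fun h => by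
      rw [Nat.card_fun] at h
      exact cK (hr.dvd_of_dvd_pow h)
    have cLL : ∀ i, r ∣ Nat.card (L i × L i) → r ∣ Nat.card G := fun i h =>
      h.trans ((AddSubgroup.card_dvd_of_surjective _ (hp i).surjective).trans hcardM)
    have cL : ∀ i, r ∣ Nat.card (L i) → r ∣ Nat.card G := fun i h =>
      cLL i (by rw [Nat.card_prod]; exact h.mul_right _)
    have cH : ∀ i, r ∣ Nat.card (HeisenbergGroup (ν i)) → r ∣ Nat.card G := fun i h => by
      rw [HeisenbergGroup.natCard, hr'.dvd_mul, hr'.dvd_mul] at h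
      exact h.elim (fun h => h.elim (cL i) (cL i)) cK
    rintro (h | h | h | h | h | ⟨i, h | h | h⟩ | h | h | h)
    · exact cA h
    · exact cB h
    · exact cC h
    · rw [Nat.card_prod, hr'.dvd_mul] at h
      exact h.elim cA cB
    · rw [HeisenbergGroup.natCard, hr'.dvd_mul, hr'.dvd_mul] at h
      exact h.elim (fun h => h.elim cA cB) cC
    · exact cL i h
    · exact cK h
    · exact cH i h
    · exact cC h
    · rw [Nat.card_pi, hr'.dvd_finsetProd_iff] at h
      obtain ⟨i, -, h⟩ := h
      exact cH i h
    · rw [Nat.card_pi, hr'.dvd_finsetProd_iff] at h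
      obtain ⟨i, -, h⟩ := h
      exact cLL i h
  · rw [← hrankM]
    exact AddGroup.rank_le_of_surjective _ hA
  · rw [← hrankM]
    exact AddGroup.rank_le_of_surjective _ hB
  · intro i
    rw [← hrankM]
    exact AddGroup.rank_le_of_surjective _ (hp i).surjective
  · intro i
    refine ⟨inferInstance, hK1, hK1.trans ?_⟩
    rw [hC]
    -- The existence of an index i gives d(Z(G)) ≥ 1.
    exact i.pos
  · have h := Monoid.exponent_dvd_of_monoidHom f.right hright
    rwa [Monoid.exponent_multiplicative] at h
  · rw [AddMonoid.exponent_prod]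
    refine (lcm_dvd (AddMonoid.exponent_dvd_of_surjective _ hA)
      (AddMonoid.exponent_dvd_of_surjective _ hB)).trans ?_
    rw [hexpM]
    exact exponent_quotient_center_dvd_exponent_commutator hcen
  · have hle : commutator G ≤ Subgroup.center G :=
      Subgroup.commutator_le.2 fun g _ h _ => hcen g h
    exact Monoid.exponent_dvd_of_monoidHom _ (Subgroup.inclusion_injective hle)
  · have h := Monoid.exponent_dvd_of_monoidHom f.left hleft
    rwa [Monoid.exponent_multiplicative] at h
  · rw [AddMonoid.exponent_dvd_iff_forall_nsmul_eq_zero]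
    exact fun x => funext fun i => hKe (x i)
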